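/- Let $H$ be a complex separable Hilbert space, $\mathcal L(H)$ the bounded operators and $\mathcal T(H)$ the trace class operators on $H$; a state is a positive $\varrho\in\mathcal T(H)$ with $\mathrm{tr}[\varrho]=1$, and an effect is an operator $A\in\mathcal L(H)$ with $0\le A\le I$. An operation is a completely positive linear map $\Phi:\mathcal T(H)\to\mathcal T(H)$ with $0\le \mathrm{tr}[\Phi(\varrho)]\le 1$ for every state $\varrho$. Its dual $\Phi^*:\mathcal L(H)\to\mathcal L(H)$ is determined by $\mathrm{tr}[\Phi^*(R)T]=\mathrm{tr}[R\,\Phi(T)]$ for all $R\in\mathcal L(H)$, $T\in\mathcal T(H)$, and $\Phi^*(I)$ is the effect associated with $\Phi$. An instrument on a measurable space $(\Omega,\mathcal F)$ is a map $X\mapsto\mathcal J_X$ from $\mathcal F$ to the operations that is $\sigma$-additive (for every $T\in\mathcal T(H)$ and pairwise disjoint $X_1,X_2,\dots\in\mathcal F$, $\mathcal J_{\bigcup_n X_n}(T)=\sum_n\mathcal J_{X_n}(T)$ in trace norm) and satisfies $\mathrm{tr}[\mathcal J_\Omega(\varrho)]=1$ for every state $\varrho$. An observable (POVM) on $(\Omega,\mathcal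 F)$ is a map $X\mapsto\mathsf G(X)$ from $\mathcal F$ to the effects that is $\sigma$-additive in the weak operator topology and satisfies $\mathsf G(\Omega)=I$. Two operations are called coexistent if they both lie in the range of a single instrument, and two effects are called coexistent if they both lie in the range of a single observable. If two operations $\Phi$ and $\Psi$ on $\mathcal T(H)$ are coexistent, then their associated effects $A=\Phi^*(I)$ and $B=\Psi^*(I)$ are coexistent. -/

import Mathlib

open scoped ComplexOrder

universe u v

namespace Quantum

open InnerProductSpace

/-! ### Trace class operators and the trace -/

section TraceClass

/-- `T = ∑ₙ |xₙ⟩⟨yₙ|` with `∑ₙ ‖xₙ‖ ‖yₙ‖ < ∞`. -/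
structure IsNuclearRep {H : Type*} [NormedAddCommGroup H] [InnerProductSpace ℂ H]
    (T : H →L[ℂ] H) (x y : ℕ → H) : Prop where
  summable : Summable fun n => ‖x n‖ * ‖y n‖
  hasSum : HasSum (fun n => rankOne ℂ (x n) (y n)) T

theorem IsNuclearRep.add {H : Type*} [NormedAddCommGroup H] [InnerProductSpace ℂ H]
    {T T' : H →L[ℂ] H} {x y x' y' : ℕ → H}
    (h : IsNuclearRep T x y) (h' : IsNuclearRep T' x' y') :
    IsNuclearRep (T + T')
      (fun n => Sum.elim x x' (Equiv.natSumNatEquivNat.symm n))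
      (fun n => Sum.elim y y' (Equiv.natSumNatEquivNat.symm n)) := by
  have e : ∀ k : ℕ, Equiv.natSumNatEquivNat.symm (2 * k) = Sum.inl k := fun k => by
    rw [Equiv.symm_apply_eq]; simp
  have o : ∀ k : ℕ, Equiv.natSumNatEquivNat.symm (2 * k + 1) = Sum.inr k := fun k => by
    rw [Equiv.symm_apply_eq]; simp
  constructor
  · refine HasSum.summable (a := (∑' n, ‖x n‖ * ‖y n‖) + ∑' n, ‖x' n‖ * ‖y' n‖)
      (HasSum.even_add_odd ?_ ?_)
    · simpa only [e, Sum.elim_inl] using h.summable.hasSum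
    · simpa only [o, Sum.elim_inr] using h'.summable.hasSum
  · refine HasSum.even_add_odd ?_ ?_
    · simpa only [e, Sum.elim_inl] using h.hasSum
    · simpa only [o, Sum.elim_inr] using h'.hasSum

theorem IsNuclearRep.comp_left {H : Type*} [NormedAddCommGroup H] [InnerProductSpace ℂ H]
    {T : H →L[ℂ] H} {x y : ℕ → H} (h : IsNuclearRep T x y) (R : H →L[ℂ] H) :
    IsNuclearRep (R ∘L T) (fun n => R (x n)) y := by
  constructor
  · refine Summable.of_nonneg_of_le (fun n => by positivity) (fun n => ?_)
      (h.summable.mul_left ‖R‖)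
    rw [← mul_assoc]
    gcongr
    exact R.le_opNorm _
  · have := h.hasSum.mapL (ContinuousLinearMap.compL ℂ H H H R)
    simpa [comp_rankOne] using this

/-- The trace class operators on a Hilbert space: the operators `∑ₙ |xₙ⟩⟨yₙ|` with
`∑ₙ ‖xₙ‖ ‖yₙ‖ < ∞` (equivalently, those `T` for which `|T|` has finite trace). -/
def traceClass (H : Type*) [NormedAddCommGroup H] [InnerProductSpace ℂ H] :
    Submodule ℂ (H →L[ℂ] H) where
  carrier := {T | ∃ x y : ℕ → H, IsNuclearRep T x y}
  zero_mem' := ⟨0, 0, by simp, by simp⟩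
  add_mem' := by
    rintro T T' ⟨x, y, h⟩ ⟨x', y', h'⟩
    exact ⟨_, _, h.add h'⟩
  smul_mem' := by
    rintro c T ⟨x, y, h⟩
    have e : c • T = (c • (1 : H →L[ℂ] H)) ∘L T := by ext z; simp
    exact ⟨_, _, e ▸ h.comp_left (c • (1 : H →L[ℂ] H))⟩

theorem comp_mem_traceClass {H : Type*} [NormedAddCommGroup H] [InnerProductSpace ℂ H]
    (R : H →L[ℂ] H) {T : H →L[ℂ] H} (hT : T ∈ traceClass H) : R ∘L T ∈ traceClass H := by
  obtain ⟨x, y, h⟩ := hT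
  exact ⟨_, _, h.comp_left R⟩

/-- The trace `∑ᵢ ⟨eᵢ, T eᵢ⟩` with respect to a Hilbert basis `e`. For trace class `T` the series
converges and does not depend on the basis, see `hasSum_trace`. -/
noncomputable def trace {H : Type*} [NormedAddCommGroup H] [InnerProductSpace ℂ H]
    [CompleteSpace H] (T : H →L[ℂ] H) : ℂ :=
  ∑' i, inner ℂ ((exists_hilbertBasis ℂ H).choose_spec.choose i)
    (T ((exists_hilbertBasis ℂ H).choose_spec.choose i))

theorem IsNuclearRep.hasSum_inner {H : Type*} [NormedAddCommGroup H] [InnerProductSpace ℂ H]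
    {T : H →L[ℂ] H} {x y : ℕ → H} (h : IsNuclearRep T x y) (u v : H) :
    HasSum (fun n => inner ℂ (y n) v * inner ℂ u (x n)) (inner ℂ u (T v)) := by
  have h1 := h.hasSum.mapL (ContinuousLinearMap.apply ℂ H v)
  have h2 := h1.mapL (innerSL ℂ u)
  simpa [rankOne_apply, inner_smul_right] using h2

theorem IsNuclearRep.summable_inner {H : Type*} [NormedAddCommGroup H] [InnerProductSpace ℂ H]
    {T : H →L[ℂ] H} {x y : ℕ → H} (h : IsNuclearRep T x y) :
    Summable (fun n => inner ℂ (y n) (x n)) := by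
  refine Summable.of_norm_bounded h.summable (fun n => ?_)
  rw [mul_comm]
  exact norm_inner_le_norm _ _

theorem IsNuclearRep.hasSum_basis {H : Type*} [NormedAddCommGroup H] [InnerProductSpace ℂ H]
    {T : H →L[ℂ] H} {x y : ℕ → H} (h : IsNuclearRep T x y) {ι : Type*}
    (b : HilbertBasis ι ℂ H) :
    HasSum (fun i => inner ℂ (b i) (T (b i))) (∑' n, inner ℂ (y n) (x n)) := by
  have hsq : ∀ z : H, HasSum (fun i => ‖(inner ℂ (b i) z : ℂ)‖ ^ 2) (‖z‖ ^ 2) := fun z => by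
    have := (b.hasSum_inner_mul_inner z z).mapL Complex.reCLM
    have e : ∀ i, (inner ℂ z (b i) * inner ℂ (b i) z : ℂ).re = ‖(inner ℂ (b i) z : ℂ)‖ ^ 2 := by
      intro i
      rw [← inner_conj_symm z (b i), mul_comm, Complex.mul_conj, ← Complex.normSq_eq_norm_sq]
      simp
    simp only [Complex.reCLM_apply, e] at this
    convert this using 1
    rw [inner_self_eq_norm_sq_to_K]
    norm_cast
  have hfib : ∀ n, Summable (fun i => ‖(inner ℂ (y n) (b i) * inner ℂ (b i) (x n) : ℂ)‖) ∧
      ∑' i, ‖(inner ℂ (y n) (b i) * inner ℂ (b i) (x n) : ℂ)‖ ≤ ‖x n‖ * ‖y n‖ := fun n => by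
    have hb : ∀ s : Finset ι,
        ∑ i ∈ s, ‖(inner ℂ (y n) (b i) * inner ℂ (b i) (x n) : ℂ)‖ ≤ ‖x n‖ * ‖y n‖ := fun s => by
      have e : ∀ i, ‖(inner ℂ (y n) (b i) * inner ℂ (b i) (x n) : ℂ)‖ =
          ‖(inner ℂ (b i) (x n) : ℂ)‖ * ‖(inner ℂ (b i) (y n) : ℂ)‖ := fun i => by
        rw [norm_mul, norm_inner_symm, mul_comm]
      simp only [e]
      refine (Real.sum_mul_le_sqrt_mul_sqrt s _ _).trans ?_
      gcongr
      · rw [Real.sqrt_le_left (norm_nonneg _)]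
        exact sum_le_hasSum s (fun i _ => by positivity) (hsq _)
      · rw [Real.sqrt_le_left (norm_nonneg _)]
        exact sum_le_hasSum s (fun i _ => by positivity) (hsq _)
    have hs := summable_of_sum_le (fun i => norm_nonneg _) hb
    exact ⟨hs, hs.tsum_le_of_sum_le hb⟩
  have hF : Summable (fun p : ℕ × ι =>
      (inner ℂ (y p.1) (b p.2) * inner ℂ (b p.2) (x p.1) : ℂ)) := by
    refine Summable.of_norm ?_
    rw [summable_prod_of_nonneg (fun p => norm_nonneg _)]
    exact ⟨fun n => (hfib n).1, Summable.of_nonneg_of_le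
      (fun n => tsum_nonneg fun i => norm_nonneg _) (fun n => (hfib n).2) h.summable⟩
  have h1 : HasSum (fun n => (inner ℂ (y n) (x n) : ℂ))
      (∑' p : ℕ × ι, (inner ℂ (y p.1) (b p.2) * inner ℂ (b p.2) (x p.1) : ℂ)) :=
    hF.hasSum.prod_fiberwise fun n => b.hasSum_inner_mul_inner (y n) (x n)
  rw [h1.tsum_eq]
  have h2 := (Equiv.prodComm ι ℕ).hasSum_iff.mpr hF.hasSum
  exact h2.prod_fiberwise fun i => h.hasSum_inner (b i) (b i)

theorem IsNuclearRep.trace_eq {H : Type*} [NormedAddCommGroup H] [InnerProductSpace ℂ H]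
    [CompleteSpace H] {T : H →L[ℂ] H} {x y : ℕ → H} (h : IsNuclearRep T x y) :
    trace T = ∑' n, inner ℂ (y n) (x n) :=
  (h.hasSum_basis _).tsum_eq

/-- The series defining the trace of a trace class operator converges for every Hilbert basis,
with the same sum. -/
theorem hasSum_trace {H : Type*} [NormedAddCommGroup H] [InnerProductSpace ℂ H]
    [CompleteSpace H] {T : H →L[ℂ] H} (hT : T ∈ traceClass H) {ι : Type*}
    (b : HilbertBasis ι ℂ H) : HasSum (fun i => inner ℂ (b i) (T (b i))) (trace T) := by
  obtain ⟨x, y, h⟩ := hT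
  rw [h.trace_eq]
  exact h.hasSum_basis b

theorem trace_add {H : Type*} [NormedAddCommGroup H] [InnerProductSpace ℂ H]
    [CompleteSpace H] {S T : H →L[ℂ] H} (hS : S ∈ traceClass H) (hT : T ∈ traceClass H) :
    trace (S + T) = trace S + trace T := by
  obtain ⟨w, b, -⟩ := exists_hilbertBasis ℂ H
  refine (hasSum_trace (add_mem hS hT) b).unique ?_
  simpa [inner_add_right] using (hasSum_trace hS b).add (hasSum_trace hT b)

theorem trace_smul {H : Type*} [NormedAddCommGroup H] [InnerProductSpace ℂ H]
    [CompleteSpace H] (c : ℂ) {T : H →L[ℂ] H} (hT : T ∈ traceClass H) :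
    trace (c • T) = c * trace T := by
  obtain ⟨w, b, -⟩ := exists_hilbertBasis ℂ H
  refine (hasSum_trace ((traceClass H).smul_mem c hT) b).unique ?_
  simpa [inner_smul_right] using (hasSum_trace hT b).mul_left c

/-- The trace norm `‖T‖₁`, as the infimum of `∑ₙ ‖xₙ‖ ‖yₙ‖` over all representations
`T = ∑ₙ |xₙ⟩⟨yₙ|`; it equals `tr |T|`. -/
noncomputable def traceNorm {H : Type*} [NormedAddCommGroup H] [InnerProductSpace ℂ H]
    (T : traceClass H) : ℝ :=
  sInf {c : ℝ | ∃ x y : ℕ → H, IsNuclearRep (T : H →L[ℂ] H) x y ∧ c = ∑' n, ‖x n‖ * ‖y n‖}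

theorem exists_isNuclearRep {H : Type*} [NormedAddCommGroup H] [InnerProductSpace ℂ H]
    [CompleteSpace H] {x y : ℕ → H} (h : Summable fun n => ‖x n‖ * ‖y n‖) :
    ∃ T : H →L[ℂ] H, IsNuclearRep T x y :=
  ⟨_, h, (Summable.of_norm (by simpa using h)).hasSum⟩

theorem isNuclearRep_rankOne {H : Type*} [NormedAddCommGroup H] [InnerProductSpace ℂ H]
    (x y : H) : IsNuclearRep (rankOne ℂ x y) (Pi.single 0 x) (Pi.single 0 y) := by
  have h0 : ∀ n : ℕ, n ≠ 0 → (Pi.single 0 x : ℕ → H) n = 0 := fun n hn => by simp [hn]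
  refine ⟨(hasSum_single 0 fun n hn => by simp [h0 n hn]).summable, ?_⟩
  simpa using hasSum_single (f := fun n : ℕ =>
    rankOne ℂ ((Pi.single 0 x : ℕ → H) n) ((Pi.single 0 y : ℕ → H) n)) 0
    fun n hn => by simp [h0 n hn]

theorem rankOne_mem_traceClass {H : Type*} [NormedAddCommGroup H] [InnerProductSpace ℂ H]
    (x y : H) : rankOne ℂ x y ∈ traceClass H :=
  ⟨_, _, isNuclearRep_rankOne x y⟩

theorem trace_rankOne {H : Type*} [NormedAddCommGroup H] [InnerProductSpace ℂ H]
    [CompleteSpace H] (x y : H) : trace (rankOne ℂ x y) = inner ℂ y x := by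
  rw [(isNuclearRep_rankOne x y).trace_eq, tsum_eq_single 0 fun n hn => by simp [hn]]
  simp

theorem isPositive_of_inner_nonneg {H : Type*} [NormedAddCommGroup H] [InnerProductSpace ℂ H]
    [CompleteSpace H] {T : H →L[ℂ] H} (h : ∀ v, (0 : ℂ) ≤ inner ℂ v (T v)) :
    T.IsPositive := by
  rw [ContinuousLinearMap.isPositive_iff_complex]
  intro v
  have h1 := Complex.nonneg_iff.mp (h v)
  have h2 : (inner ℂ (T v) v : ℂ) = inner ℂ v (T v) := by
    rw [← inner_conj_symm (T v) v]
    apply Complex.ext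
    · rw [Complex.conj_re]
    · rw [Complex.conj_im, ← h1.2, neg_zero]
  rw [h2]
  refine ⟨?_, h1.1⟩
  apply Complex.ext
  · simp
  · simpa using h1.2

theorem IsNuclearRep.isPositive {H : Type*} [NormedAddCommGroup H] [InnerProductSpace ℂ H]
    [CompleteSpace H] {T : H →L[ℂ] H} {u : ℕ → H} (h : IsNuclearRep T u u) :
    T.IsPositive := by
  refine isPositive_of_inner_nonneg fun v => (h.hasSum_inner v v).nonneg fun n => ?_
  rw [← inner_conj_symm v (u n), Complex.mul_conj]
  exact_mod_cast Complex.normSq_nonneg _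

theorem IsNuclearRep.trace_self {H : Type*} [NormedAddCommGroup H] [InnerProductSpace ℂ H]
    [CompleteSpace H] {T : H →L[ℂ] H} {u : ℕ → H} (h : IsNuclearRep T u u) :
    trace T = ((∑' n, ‖u n‖ * ‖u n‖ : ℝ) : ℂ) := by
  rw [h.trace_eq, Complex.ofReal_tsum]
  refine tsum_congr fun n => ?_
  rw [inner_self_eq_norm_sq_to_K]
  push_cast
  rw [sq]
  rfl

/-- A balanced choice of the two vectors of a rank one operator. -/
theorem exists_balanced {H : Type*} [NormedAddCommGroup H] [InnerProductSpace ℂ H]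
    (x y : H) : ∃ a b : H, rankOne ℂ a b = rankOne ℂ x y ∧
      ‖a‖ * ‖a‖ = ‖x‖ * ‖y‖ ∧ ‖b‖ * ‖b‖ = ‖x‖ * ‖y‖ := by
  by_cases hx : x = 0
  · exact ⟨0, 0, by simp [hx], by simp [hx], by simp [hx]⟩
  by_cases hy : y = 0
  · exact ⟨0, 0, by simp [hy], by simp [hy], by simp [hy]⟩
  have hx' : 0 < ‖x‖ := norm_pos_iff.mpr hx
  have hy' : 0 < ‖y‖ := norm_pos_iff.mpr hy
  have ht : 0 < Real.sqrt (‖y‖ / ‖x‖) := Real.sqrt_pos.mpr (by positivity)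
  have ht2 : Real.sqrt (‖y‖ / ‖x‖) * Real.sqrt (‖y‖ / ‖x‖) = ‖y‖ / ‖x‖ :=
    Real.mul_self_sqrt (by positivity)
  set t := Real.sqrt (‖y‖ / ‖x‖) with htdef
  refine ⟨(t : ℂ) • x, ((t⁻¹ : ℝ) : ℂ) • y, ?_, ?_, ?_⟩
  · ext z
    have : (t : ℂ) ≠ 0 := by exact_mod_cast ht.ne'
    simp only [rankOne_apply, inner_smul_left, smul_smul, Complex.conj_ofReal]
    congr 1
    push_cast
    field_simp
  · rw [norm_smul, Complex.norm_real, Real.norm_of_nonneg ht.le]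
    calc t * ‖x‖ * (t * ‖x‖) = (t * t) * ‖x‖ * ‖x‖ := by ring
      _ = ‖x‖ * ‖y‖ := by rw [ht2]; field_simp
  · rw [norm_smul, Complex.norm_real, Real.norm_of_nonneg (inv_nonneg.mpr ht.le)]
    calc t⁻¹ * ‖y‖ * (t⁻¹ * ‖y‖) = (t * t)⁻¹ * ‖y‖ * ‖y‖ := by rw [mul_inv]; ring
      _ = ‖x‖ * ‖y‖ := by rw [ht2]; field_simp

theorem norm_le_of_isNuclearRep {H : Type*} [NormedAddCommGroup H] [InnerProductSpace ℂ H]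
    [CompleteSpace H] (g : traceClass H →ₗ[ℂ] ℂ) (C : ℝ)
    (hg : ∀ (P : traceClass H) (u : ℕ → H), IsNuclearRep (P : H →L[ℂ] H) u u →
      ‖g P‖ ≤ C * ∑' n, ‖u n‖ * ‖u n‖) (hC : 0 ≤ C)
    (T : traceClass H) {x y : ℕ → H} (h : IsNuclearRep (T : H →L[ℂ] H) x y) :
    ‖g T‖ ≤ 4 * C * ∑' n, ‖x n‖ * ‖y n‖ := by
  choose a b hab ha hb using fun n => exists_balanced (x n) (y n)
  have key : ∀ c : ℂ, ‖c‖ = 1 → ∃ P : traceClass H,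
      IsNuclearRep (P : H →L[ℂ] H) (fun n => a n + c • b n) (fun n => a n + c • b n) ∧
      ‖g P‖ ≤ 4 * C * ∑' n, ‖x n‖ * ‖y n‖ := fun c hc => by
    have hle : ∀ n, ‖a n + c • b n‖ * ‖a n + c • b n‖ ≤ 4 * (‖x n‖ * ‖y n‖) := fun n => by
      have e : ‖a n‖ = ‖b n‖ := by
        rw [← mul_self_inj (norm_nonneg _) (norm_nonneg _), ha, hb]
      have h1 : ‖a n + c • b n‖ ≤ 2 * ‖a n‖ := by
        refine (norm_add_le _ _).trans ?_
        rw [norm_smul, hc, ← e]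
        linarith
      have h2 := mul_self_le_mul_self (norm_nonneg _) h1
      linarith [ha n]
    have hs : Summable fun n => ‖a n + c • b n‖ * ‖a n + c • b n‖ :=
      Summable.of_nonneg_of_le (fun n => by positivity) hle (h.summable.mul_left 4)
    obtain ⟨P, hP⟩ := exists_isNuclearRep hs
    refine ⟨⟨P, _, _, hP⟩, hP, (hg _ _ hP).trans ?_⟩
    have := hs.tsum_le_tsum hle (h.summable.mul_left 4)
    rw [tsum_mul_left] at this
    calc C * _ ≤ C * (4 * ∑' n, ‖x n‖ * ‖y n‖) := by gcongr
      _ = _ := by ring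
  obtain ⟨P1, r1, h1⟩ := key 1 (by simp)
  obtain ⟨P2, r2, h2⟩ := key Complex.I (by simp)
  obtain ⟨P3, r3, h3⟩ := key (-1) (by simp)
  obtain ⟨P4, r4, h4⟩ := key (-Complex.I) (by simp)
  have hT : (4 : ℂ) • T = P1 + Complex.I • P2 - P3 - Complex.I • P4 := by
    apply Subtype.ext
    have hs := ((r1.hasSum.add (r2.hasSum.const_smul Complex.I)).sub r3.hasSum).sub
      (r4.hasSum.const_smul Complex.I)
    refine HasSum.unique (h.hasSum.const_smul (4 : ℂ)) ?_
    refine (congrArg (fun f => HasSum f _) (funext fun n => ?_)).mpr hs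
    rw [← hab n]
    simp only [map_add, map_smulₛₗ, add_apply, smul_apply,
      RingHom.id_apply, smul_add, smul_smul, map_one, map_neg, Complex.conj_I]
    ring_nf
    simp only [Complex.I_sq]
    module
  have hg4 : (4 : ℂ) * g T = g P1 + Complex.I * g P2 - g P3 - Complex.I * g P4 := by
    simpa using congrArg g hT
  have hn : 4 * ‖g T‖ ≤ ‖g P1‖ + ‖g P2‖ + ‖g P3‖ + ‖g P4‖ := by
    have e : 4 * ‖g T‖ = ‖(4 : ℂ) * g T‖ := by simp
    rw [e, hg4]
    refine (norm_sub_le _ _).trans ?_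
    refine (add_le_add_left (norm_sub_le _ _) _).trans ?_
    refine (add_le_add_left (add_le_add_left (norm_add_le _ _) _) _).trans ?_
    simp
  linarith

/-- A linear functional on the trace class operators which is bounded on positive operators is of
the form `T ↦ tr (S T)`. -/
theorem exists_trace_repr {H : Type*} [NormedAddCommGroup H] [InnerProductSpace ℂ H]
    [CompleteSpace H] (g : traceClass H →ₗ[ℂ] ℂ) (C : ℝ)
    (hg : ∀ (P : traceClass H) (u : ℕ → H), IsNuclearRep (P : H →L[ℂ] H) u u →
      ‖g P‖ ≤ C * ∑' n, ‖u n‖ * ‖u n‖) (hC : 0 ≤ C) :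
    ∃ S : H →L[ℂ] H, ∀ T : traceClass H, trace (S ∘L (T : H →L[ℂ] H)) = g T := by
  have hL := fun T {x y} => norm_le_of_isNuclearRep g C hg hC T (x := x) (y := y)
  let B : H →ₗ⋆[ℂ] H →ₗ[ℂ] ℂ := LinearMap.mk₂'ₛₗ (starRingEnd ℂ) (RingHom.id ℂ)
    (fun v w => g ⟨rankOne ℂ w v, rankOne_mem_traceClass w v⟩)
    (fun v v' w => by
      rw [← map_add]; congr 1; apply Subtype.ext; simp)
    (fun c v w => by
      rw [← map_smul]; congr 1; apply Subtype.ext; simp)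
    (fun v w w' => by
      rw [← map_add]; congr 1; apply Subtype.ext; simp)
    (fun c v w => by
      simp only [RingHom.id_apply]
      rw [← map_smul]; congr 1; apply Subtype.ext; simp)
  have hB : ∀ v w, B v w = g ⟨rankOne ℂ w v, rankOne_mem_traceClass w v⟩ := fun v w => rfl
  have hBb : ∀ v w, ‖B v w‖ ≤ 4 * C * ‖v‖ * ‖w‖ := fun v w => by
    have := hL ⟨rankOne ℂ w v, rankOne_mem_traceClass w v⟩ (isNuclearRep_rankOne w v)
    rw [tsum_eq_single 0 fun n hn => by simp [hn]] at this
    rw [hB]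
    refine this.trans (le_of_eq ?_)
    simp
    ring
  let S : H →L[ℂ] H :=
    ContinuousLinearMap.adjoint (continuousLinearMapOfBilin (B.mkContinuous₂ (4 * C) hBb))
  have hS : ∀ v w, inner ℂ v (S w) = g ⟨rankOne ℂ w v, rankOne_mem_traceClass w v⟩ :=
    fun v w => by
      rw [ContinuousLinearMap.adjoint_inner_right, continuousLinearMapOfBilin_apply,
        LinearMap.mkContinuous₂_apply, hB]
  refine ⟨S, fun T => ?_⟩
  obtain ⟨x, y, h⟩ := T.2
  have hs := (h.comp_left S).summable_inner.hasSum.tendsto_sum_nat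
  rw [← (h.comp_left S).trace_eq] at hs
  refine tendsto_nhds_unique hs ?_
  rw [tendsto_iff_norm_sub_tendsto_zero]
  have h0 := (tendsto_sum_nat_add fun n => ‖x n‖ * ‖y n‖).const_mul (4 * C)
  rw [mul_zero] at h0
  refine squeeze_zero (fun N => norm_nonneg _) (fun N => ?_) h0
  have hrep : IsNuclearRep ((T - ∑ n ∈ Finset.range N,
      ⟨rankOne ℂ (x n) (y n), rankOne_mem_traceClass _ _⟩ : traceClass H) : H →L[ℂ] H)
      (fun n => x (n + N)) (fun n => y (n + N)) := by
    refine ⟨(summable_nat_add_iff N).mpr h.summable, ?_⟩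
    have := (hasSum_nat_add_iff' N).mpr h.hasSum
    simpa using this
  have := hL _ hrep
  rw [map_sub, map_sum, norm_sub_rev] at this
  simpa only [hS] using this

theorem trace_nonneg {H : Type*} [NormedAddCommGroup H] [InnerProductSpace ℂ H]
    [CompleteSpace H] {T : H →L[ℂ] H} (hT : T ∈ traceClass H) (hp : T.IsPositive) :
    0 ≤ trace T := by
  obtain ⟨w, b, -⟩ := exists_hilbertBasis ℂ H
  exact (hasSum_trace hT b).nonneg fun i => hp.inner_nonneg_right _

theorem trace_comp_nonneg {H : Type*} [NormedAddCommGroup H] [InnerProductSpace ℂ H]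
    [CompleteSpace H] {R T : H →L[ℂ] H} (hR : 0 ≤ R) (hT : T ∈ traceClass H)
    (hp : T.IsPositive) : 0 ≤ trace (R ∘L T) := by
  obtain ⟨P, rfl⟩ := CStarAlgebra.nonneg_iff_eq_star_mul_self.mp hR
  obtain ⟨x, y, h⟩ := hT
  have h1 : IsNuclearRep (P ∘L T ∘L ContinuousLinearMap.adjoint P) (fun n => P (x n))
      (fun n => P (y n)) := by
    constructor
    · refine Summable.of_nonneg_of_le (fun n => by positivity) (fun n => ?_)
        (h.summable.mul_left (‖P‖ * ‖P‖))
      calc ‖P (x n)‖ * ‖P (y n)‖ ≤ (‖P‖ * ‖x n‖) * (‖P‖ * ‖y n‖) := by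
            gcongr <;> exact P.le_opNorm _
        _ = _ := by ring
    · have := ((h.comp_left P).hasSum).mapL
        ((ContinuousLinearMap.compL ℂ H H H).flip (ContinuousLinearMap.adjoint P))
      simpa [rankOne_comp, ContinuousLinearMap.comp_assoc] using this
  have h2 : trace ((star P * P) ∘L T) = trace (P ∘L T ∘L ContinuousLinearMap.adjoint P) := by
    rw [h1.trace_eq, (h.comp_left _).trace_eq]
    refine tsum_congr fun n => ?_
    rw [ContinuousLinearMap.star_eq_adjoint, mul_apply_eq_comp,
      ContinuousLinearMap.adjoint_inner_right]
  rw [h2]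
  exact trace_nonneg ⟨_, _, h1⟩ (hp.conj_adjoint P)

end TraceClass

/-! ### States, operations and instruments -/

section Operations

/-- A state is a positive operator of trace one. -/
def IsState {H : Type*} [NormedAddCommGroup H] [InnerProductSpace ℂ H] [CompleteSpace H]
    (ρ : traceClass H) : Prop :=
  (ρ : H →L[ℂ] H).IsPositive ∧ trace (ρ : H →L[ℂ] H) = 1

/-- Positivity of the operator on `Hⁿ` with the block matrix `(T i j)`. -/
def IsBlockPositive {H : Type*} [NormedAddCommGroup H] [InnerProductSpace ℂ H] {n : ℕ}
    (T : Fin n → Fin n → traceClass H) : Prop :=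
  ∀ x : Fin n → H, 0 ≤ ∑ i, ∑ j, inner ℂ (x i) ((T i j : H →L[ℂ] H) (x j))

/-- Complete positivity: all amplifications `(T i j) ↦ (Φ (T i j))` to block matrices
are positive. -/
def IsCompletelyPositive {H : Type*} [NormedAddCommGroup H] [InnerProductSpace ℂ H]
    (Φ : traceClass H →ₗ[ℂ] traceClass H) : Prop :=
  ∀ (n : ℕ) (T : Fin n → Fin n → traceClass H),
    IsBlockPositive T → IsBlockPositive fun i j => Φ (T i j)

/-- An operation: a completely positive linear map on the trace class operators with
`0 ≤ tr (Φ ρ) ≤ 1` for all states `ρ`. -/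
structure Operation (H : Type*) [NormedAddCommGroup H] [InnerProductSpace ℂ H]
    [CompleteSpace H] where
  toLinearMap : traceClass H →ₗ[ℂ] traceClass H
  completelyPositive : IsCompletelyPositive toLinearMap
  trace_bounds : ∀ ρ : traceClass H, IsState ρ →
    0 ≤ trace (toLinearMap ρ : H →L[ℂ] H) ∧ trace (toLinearMap ρ : H →L[ℂ] H) ≤ 1

theorem Operation.isPositive_map {H : Type*} [NormedAddCommGroup H] [InnerProductSpace ℂ H]
    [CompleteSpace H] (Φ : Operation H) {T : traceClass H} (hT : (T : H →L[ℂ] H).IsPositive) :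
    (Φ.toLinearMap T : H →L[ℂ] H).IsPositive := by
  have h := Φ.completelyPositive 1 (fun _ _ => T) fun x => by
    simpa using hT.inner_nonneg_right (x 0)
  exact isPositive_of_inner_nonneg fun v => by simpa using h fun _ => v

theorem Operation.trace_map_le {H : Type*} [NormedAddCommGroup H] [InnerProductSpace ℂ H]
    [CompleteSpace H] (Φ : Operation H) {T : traceClass H} {u : ℕ → H}
    (h : IsNuclearRep (T : H →L[ℂ] H) u u) :
    trace (Φ.toLinearMap T : H →L[ℂ] H) ≤ ((∑' n, ‖u n‖ * ‖u n‖ : ℝ) : ℂ) := by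
  set s : ℝ := ∑' n, ‖u n‖ * ‖u n‖ with hs
  have hs0 : 0 ≤ s := tsum_nonneg fun n => by positivity
  rcases hs0.eq_or_lt with h0 | h0
  · have hu : ∀ n, u n = 0 := fun n => by
      have := h.summable.le_tsum n fun m _ => by positivity
      rw [← hs, ← h0] at this
      have h2 := mul_self_eq_zero.mp (le_antisymm this (by positivity))
      simpa using h2
    have hT : T = 0 := by
      apply Subtype.ext
      refine h.hasSum.unique ?_
      simp [hu]
    rw [hT, ← h0, map_zero]
    refine (le_of_eq ?_)
    simpa using trace_smul 0 (zero_mem (traceClass H))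
  · have hc : (s : ℂ) ≠ 0 := by exact_mod_cast h0.ne'
    have hst : IsState ((s : ℂ)⁻¹ • T) := by
      refine ⟨?_, ?_⟩
      · have := h.isPositive.smul_of_nonneg (c := ((s⁻¹ : ℝ) : ℂ))
          (by exact_mod_cast (inv_pos.mpr h0).le)
        simpa using this
      · rw [Submodule.coe_smul, trace_smul _ T.2, h.trace_self, ← hs, inv_mul_cancel₀ hc]
    have h1 := (Φ.trace_bounds _ hst).2
    rw [map_smul, Submodule.coe_smul, trace_smul _ (Φ.toLinearMap T).2] at h1
    have h2 := mul_le_mul_of_nonneg_left h1 (show (0 : ℂ) ≤ s by exact_mod_cast h0.le)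
    rwa [mul_inv_cancel_left₀ hc, mul_one] at h2

theorem Operation.existsUnique_dual {H : Type*} [NormedAddCommGroup H] [InnerProductSpace ℂ H]
    [CompleteSpace H] (Φ : Operation H) (R : H →L[ℂ] H) :
    ∃! S : H →L[ℂ] H, ∀ T : traceClass H,
      trace (S ∘L (T : H →L[ℂ] H)) = trace (R ∘L (Φ.toLinearMap T : H →L[ℂ] H)) := by
  refine existsUnique_of_exists_of_unique ?_ ?_
  · have hR : R ∈ Submodule.span ℂ {a : H →L[ℂ] H | 0 ≤ a} := by
      rw [CStarAlgebra.span_nonneg]; trivial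
    induction hR using Submodule.span_induction with
    | zero => exact ⟨0, fun T => by simp⟩
    | add R R' _ _ h h' =>
      obtain ⟨S, hS⟩ := h
      obtain ⟨S', hS'⟩ := h'
      refine ⟨S + S', fun T => ?_⟩
      rw [ContinuousLinearMap.add_comp, ContinuousLinearMap.add_comp,
        trace_add (comp_mem_traceClass _ T.2) (comp_mem_traceClass _ T.2),
        trace_add (comp_mem_traceClass _ (Φ.toLinearMap T).2)
          (comp_mem_traceClass _ (Φ.toLinearMap T).2), hS, hS']
    | smul c R _ h =>
      obtain ⟨S, hS⟩ := h
      refine ⟨c • S, fun T => ?_⟩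
      rw [ContinuousLinearMap.smul_comp, ContinuousLinearMap.smul_comp,
        trace_smul _ (comp_mem_traceClass _ T.2),
        trace_smul _ (comp_mem_traceClass _ (Φ.toLinearMap T).2), hS]
    | mem R hR =>
      let g : traceClass H →ₗ[ℂ] ℂ :=
        { toFun := fun T => trace (R ∘L (Φ.toLinearMap T : H →L[ℂ] H))
          map_add' := fun T T' => by
            rw [map_add, Submodule.coe_add, ContinuousLinearMap.comp_add,
              trace_add (comp_mem_traceClass _ (Φ.toLinearMap T).2)
                (comp_mem_traceClass _ (Φ.toLinearMap T').2)]
          map_smul' := fun c T => by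
            rw [map_smul, Submodule.coe_smul, ContinuousLinearMap.comp_smul,
              trace_smul _ (comp_mem_traceClass _ (Φ.toLinearMap T).2)]
            rfl }
      refine exists_trace_repr g ‖R‖ (fun P u h => ?_) (norm_nonneg _)
      have hp := Φ.isPositive_map h.isPositive
      have hm := (Φ.toLinearMap P).2
      have h0 : 0 ≤ g P := trace_comp_nonneg hR hm hp
      have hle : R ≤ algebraMap ℝ (H →L[ℂ] H) ‖R‖ :=
        (IsSelfAdjoint.of_nonneg hR).le_algebraMap_norm_self
      have h1 := trace_comp_nonneg (sub_nonneg.mpr hle) hm hp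
      have e : (algebraMap ℝ (H →L[ℂ] H) ‖R‖ - R) ∘L (Φ.toLinearMap P : H →L[ℂ] H) =
          (‖R‖ : ℂ) • (Φ.toLinearMap P : H →L[ℂ] H) +
            (-1 : ℂ) • (R ∘L (Φ.toLinearMap P : H →L[ℂ] H)) := by
        ext z
        simp [Algebra.algebraMap_eq_smul_one, sub_eq_add_neg]
      rw [e, trace_add ((traceClass H).smul_mem _ hm)
        ((traceClass H).smul_mem _ (comp_mem_traceClass _ hm)), trace_smul _ hm,
        trace_smul _ (comp_mem_traceClass _ hm)] at h1
      have h2 : g P ≤ ‖R‖ * trace (Φ.toLinearMap P : H →L[ℂ] H) := by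
        have : g P = trace (R ∘L (Φ.toLinearMap P : H →L[ℂ] H)) := rfl
        rw [← sub_nonneg, this]
        convert h1 using 1
        ring
      have h3 := h2.trans (mul_le_mul_of_nonneg_left (Φ.trace_map_le h)
        (show (0 : ℂ) ≤ ‖R‖ by exact_mod_cast norm_nonneg R))
      have h4 := CStarAlgebra.norm_le_norm_of_nonneg_of_le h0 h3
      refine h4.trans (le_of_eq ?_)
      rw [norm_mul, Complex.norm_real, Complex.norm_real, Real.norm_of_nonneg (norm_nonneg _),
        Real.norm_of_nonneg (tsum_nonneg fun n => by positivity)]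
  · intro S S' hS hS'
    ext w
    refine ext_inner_left ℂ fun v => ?_
    have h := (hS ⟨_, rankOne_mem_traceClass w v⟩).trans
      (hS' ⟨_, rankOne_mem_traceClass w v⟩).symm
    simpa [comp_rankOne, trace_rankOne] using h

/-- The dual map `Φ* : L(H) → L(H)`, determined by `tr (Φ*(R) T) = tr (R Φ(T))` for all trace
class `T`. -/
noncomputable def Operation.dual {H : Type*} [NormedAddCommGroup H] [InnerProductSpace ℂ H]
    [CompleteSpace H] (Φ : Operation H) (R : H →L[ℂ] H) : H →L[ℂ] H :=
  (Φ.existsUnique_dual R).choose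

theorem Operation.trace_dual_comp {H : Type*} [NormedAddCommGroup H] [InnerProductSpace ℂ H]
    [CompleteSpace H] (Φ : Operation H) (R : H →L[ℂ] H) (T : traceClass H) :
    trace (Φ.dual R ∘L (T : H →L[ℂ] H)) = trace (R ∘L (Φ.toLinearMap T : H →L[ℂ] H)) :=
  (Φ.existsUnique_dual R).choose_spec.1 T

/-- The effect `Φ*(I)` associated with an operation `Φ`. -/
noncomputable def Operation.effect {H : Type*} [NormedAddCommGroup H] [InnerProductSpace ℂ H]
    [CompleteSpace H] (Φ : Operation H) : H →L[ℂ] H :=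
  Φ.dual 1

/-- An instrument: an operation valued measure `X ↦ J X`, σ-additive in the sense that
`J (⋃ₙ Xₙ) T = ∑ₙ J Xₙ T` in trace norm for every trace class `T`, and normalized by
`tr (J Ω ρ) = 1` for all states `ρ`. Only the values on measurable sets matter. -/
structure Instrument (Ω : Type*) [MeasurableSpace Ω] (H : Type*) [NormedAddCommGroup H]
    [InnerProductSpace ℂ H] [CompleteSpace H] where
  toFun : Set Ω → Operation H
  sigma_additive : ∀ X : ℕ → Set Ω, (∀ n, MeasurableSet (X n)) →
    Pairwise (Function.onFun Disjoint X) → ∀ T : traceClass H,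
      Filter.Tendsto
        (fun N => traceNorm ((toFun (⋃ n, X n)).toLinearMap T -
          ∑ n ∈ Finset.range N, (toFun (X n)).toLinearMap T))
        Filter.atTop (nhds 0)
  normalized : ∀ ρ : traceClass H, IsState ρ →
    trace ((toFun Set.univ).toLinearMap ρ : H →L[ℂ] H) = 1

/-- The range of an instrument. -/
def Instrument.range {Ω : Type*} [MeasurableSpace Ω] {H : Type*} [NormedAddCommGroup H]
    [InnerProductSpace ℂ H] [CompleteSpace H] (J : Instrument Ω H) : Set (Operation H) :=
  {Φ | ∃ X : Set Ω, MeasurableSet X ∧ J.toFun X = Φ}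

/-- Two operations are coexistent if they both lie in the range of one instrument. -/
def Operation.Coexistent {H : Type u} [NormedAddCommGroup H] [InnerProductSpace ℂ H]
    [CompleteSpace H] (Φ Ψ : Operation H) : Prop :=
  ∃ (Ω : Type v) (_ : MeasurableSpace Ω) (J : Instrument Ω H), Φ ∈ J.range ∧ Ψ ∈ J.range

end Operations

/-! ### Effects and observables -/

section Effects

/-- An effect: `0 ≤ A ≤ I` in the order `A ≤ B ↔ B - A` positive. -/
def IsEffect {H : Type*} [NormedAddCommGroup H] [InnerProductSpace ℂ H] [CompleteSpace H]
    (A : H →L[ℂ] H) : Prop :=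
  0 ≤ A ∧ A ≤ 1

/-- An observable (POVM): an effect valued measure with `G Ω = I`, σ-additive in the weak operator
topology. Only the values on measurable sets matter. -/
structure Observable (Ω : Type*) [MeasurableSpace Ω] (H : Type*) [NormedAddCommGroup H]
    [InnerProductSpace ℂ H] [CompleteSpace H] where
  toFun : Set Ω → H →L[ℂ] H
  isEffect : ∀ X, MeasurableSet X → IsEffect (toFun X)
  sigma_additive : ∀ X : ℕ → Set Ω, (∀ n, MeasurableSet (X n)) →
    Pairwise (Function.onFun Disjoint X) → ∀ x y : H,
      HasSum (fun n => inner ℂ x (toFun (X n) y)) (inner ℂ x (toFun (⋃ n, X n) y))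
  univ_eq_one : toFun Set.univ = 1

/-- The range of an observable. -/
def Observable.range {Ω : Type*} [MeasurableSpace Ω] {H : Type*} [NormedAddCommGroup H]
    [InnerProductSpace ℂ H] [CompleteSpace H] (G : Observable Ω H) : Set (H →L[ℂ] H) :=
  {A | ∃ X : Set Ω, MeasurableSet X ∧ G.toFun X = A}

/-- Two effects are coexistent if they both lie in the range of one observable. -/
def EffectCoexistent {H : Type u} [NormedAddCommGroup H] [InnerProductSpace ℂ H]
    [CompleteSpace H] (A B : H →L[ℂ] H) : Prop :=
  ∃ (Ω : Type v) (_ : MeasurableSpace Ω) (G : Observable Ω H), A ∈ G.range ∧ B ∈ G.range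

end Effects

end Quantum

/-!
If `J` is an instrument, then `G X = (J X)*(I)` is an observable on the same space, so two effects
whose operations lie in the range of `J` lie in the range of `G`.

Everything follows from `⟨x, Φ*(I) y⟩ = tr Φ(|y⟩⟨x|)` (`Operation.inner_effect`).
On the diagonal `x = y` it turns the trace conditions on operations and instruments into `0 ≤ G X ≤ I`
and `G Ω = I`. For σ-additivity, `|tr T| ≤ ‖T‖₁` (`norm_trace_le_traceNorm`) gives convergence of
the sequence of partial sums of `⟨x, G (Xₙ) y⟩`. Convergence in the weak operator topology is stated
as unconditional summability; on the diagonal the terms are nonnegative, so it is equivalent to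
convergence of the partial sums, and the off-diagonal case follows by polarization.
-/

namespace Quantum

open InnerProductSpace

section

variable {H : Type*} [NormedAddCommGroup H] [InnerProductSpace ℂ H] [CompleteSpace H]

theorem norm_trace_le_traceNorm (T : traceClass H) :
    ‖trace (T : H →L[ℂ] H)‖ ≤ traceNorm T := by
  obtain ⟨x₀, y₀, h₀⟩ := T.2
  refine le_csInf ⟨_, x₀, y₀, h₀, rfl⟩ ?_
  rintro c ⟨x, y, h, rfl⟩
  rw [h.trace_eq]
  refine tsum_of_norm_bounded h.summable.hasSum fun n => ?_
  rw [mul_comm]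
  exact norm_inner_le_norm _ _

theorem trace_sub {S T : H →L[ℂ] H} (hS : S ∈ traceClass H) (hT : T ∈ traceClass H) :
    trace (S - T) = trace S - trace T := by
  rw [eq_sub_iff_add_eq, ← trace_add (sub_mem hS hT) hT, sub_add_cancel]

theorem trace_sum {ι : Type*} (s : Finset ι) (T : ι → traceClass H) :
    trace ((∑ i ∈ s, T i : traceClass H) : H →L[ℂ] H) = ∑ i ∈ s, trace (T i : H →L[ℂ] H) := by
  classical
  induction s using Finset.induction_on with
  | empty => simp [trace]
  | insert a s ha ih =>
    rw [Finset.sum_insert ha, Finset.sum_insert ha, Submodule.coe_add,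
      trace_add (T a).2 (∑ i ∈ s, T i : traceClass H).2, ih]

theorem Operation.inner_effect (Φ : Operation H) (x y : H) :
    inner ℂ x (Φ.effect y) =
      trace (Φ.toLinearMap ⟨rankOne ℂ y x, rankOne_mem_traceClass y x⟩ : H →L[ℂ] H) := by
  have h := Φ.trace_dual_comp 1 ⟨rankOne ℂ y x, rankOne_mem_traceClass y x⟩
  rw [comp_rankOne, trace_rankOne] at h
  simpa using! h

theorem Operation.inner_effect_self_nonneg (Φ : Operation H) (x : H) :
    0 ≤ inner ℂ x (Φ.effect x) := by
  rw [Φ.inner_effect]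
  exact trace_nonneg (Φ.toLinearMap _).2
    (Φ.isPositive_map (isNuclearRep_rankOne x x).isPositive)

theorem Operation.inner_effect_self_le (Φ : Operation H) (x : H) :
    inner ℂ x (Φ.effect x) ≤ inner ℂ x x := by
  rw [Φ.inner_effect, ← trace_rankOne, (isNuclearRep_rankOne x x).trace_self]
  exact Φ.trace_map_le (isNuclearRep_rankOne x x)

theorem Operation.isEffect_effect (Φ : Operation H) : IsEffect Φ.effect := by
  refine ⟨ContinuousLinearMap.nonneg_iff_isPositive _ |>.mpr
    (isPositive_of_inner_nonneg Φ.inner_effect_self_nonneg), ?_⟩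
  rw [ContinuousLinearMap.le_def]
  refine isPositive_of_inner_nonneg fun x => ?_
  simpa [inner_sub_right] using! Φ.inner_effect_self_le x

theorem isState_rankOne {x : H} (hx : ‖x‖ = 1) :
    IsState (⟨rankOne ℂ x x, rankOne_mem_traceClass x x⟩ : traceClass H) :=
  ⟨(isNuclearRep_rankOne x x).isPositive, by simp [trace_rankOne, inner_self_eq_norm_sq_to_K, hx]⟩

theorem Operation.effect_eq_one (Φ : Operation H)
    (h : ∀ ρ : traceClass H, IsState ρ → trace (Φ.toLinearMap ρ : H →L[ℂ] H) = 1) :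
    Φ.effect = 1 := by
  have hunit : ∀ x : H, ‖x‖ = 1 → inner ℂ x (Φ.effect x) = 1 := fun x hx => by
    rw [Φ.inner_effect, h _ (isState_rankOne hx)]
  have hdiag : ∀ x : H, inner ℂ x (Φ.effect x) = inner ℂ x x := fun x => by
    rcases eq_or_ne x 0 with rfl | hx
    · simp
    have hn : (‖x‖ : ℂ) ≠ 0 := by exact_mod_cast norm_ne_zero_iff.mpr hx
    have h1 := hunit ((‖x‖ : ℂ)⁻¹ • x) (by simp [norm_smul, hx])
    simp only [map_smul, inner_smul_left, inner_smul_right, map_inv₀, Complex.conj_ofReal] at h1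
    rw [inner_self_eq_norm_sq_to_K]
    field_simp at h1
    simpa using h1
  have hsymm : (Φ.effect : H →L[ℂ] H).IsPositive :=
    isPositive_of_inner_nonneg Φ.inner_effect_self_nonneg
  refine ContinuousLinearMap.coe_injective ((ext_inner_map _ _).mp fun x => ?_)
  simpa using (hsymm.inner_left_eq_inner_right x x).trans (hdiag x)

section Instrument

variable {Ω : Type*} [MeasurableSpace Ω]

theorem Instrument.tendsto_sum_inner_effect (J : Instrument Ω H) {X : ℕ → Set Ω}
    (hX : ∀ n, MeasurableSet (X n)) (hd : Pairwise (Function.onFun Disjoint X)) (x y : H) :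
    Filter.Tendsto (fun N => ∑ n ∈ Finset.range N, inner ℂ x ((J.toFun (X n)).effect y))
      Filter.atTop (nhds (inner ℂ x ((J.toFun (⋃ n, X n)).effect y))) := by
  rw [tendsto_iff_norm_sub_tendsto_zero]
  refine squeeze_zero (fun N => norm_nonneg _) (fun N => ?_)
    (J.sigma_additive X hX hd ⟨rankOne ℂ y x, rankOne_mem_traceClass y x⟩)
  refine le_trans (le_of_eq ?_) (norm_trace_le_traceNorm _)
  rw [Submodule.coe_sub, trace_sub (Subtype.prop _) (Subtype.prop _), trace_sum, norm_sub_rev]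
  simp only [Operation.inner_effect]

theorem Instrument.hasSum_inner_effect_self (J : Instrument Ω H) {X : ℕ → Set Ω}
    (hX : ∀ n, MeasurableSet (X n)) (hd : Pairwise (Function.onFun Disjoint X)) (x : H) :
    HasSum (fun n => inner ℂ x ((J.toFun (X n)).effect x))
      (inner ℂ x ((J.toFun (⋃ n, X n)).effect x)) := by
  have ht := J.tendsto_sum_inner_effect hX hd x x
  have hre : ∀ Φ : Operation H,
      (inner ℂ x (Φ.effect x) : ℂ) = ((inner ℂ x (Φ.effect x) : ℂ).re : ℂ) :=
    fun Φ => Complex.eq_re_of_ofReal_le (r := 0) (by simpa using Φ.inner_effect_self_nonneg x)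
  rw [hre, funext fun n => hre (J.toFun (X n)), Complex.hasSum_ofReal,
    hasSum_iff_tendsto_nat_of_nonneg fun n =>
      (Complex.nonneg_iff.mp ((J.toFun (X n)).inner_effect_self_nonneg x)).1]
  simpa [Function.comp_def] using (Complex.continuous_re.tendsto _).comp ht

theorem Instrument.hasSum_inner_effect (J : Instrument Ω H) {X : ℕ → Set Ω}
    (hX : ∀ n, MeasurableSet (X n)) (hd : Pairwise (Function.onFun Disjoint X)) (x y : H) :
    HasSum (fun n => inner ℂ x ((J.toFun (X n)).effect y))
      (inner ℂ x ((J.toFun (⋃ n, X n)).effect y)) := by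
  have hpol : ∀ A : H →L[ℂ] H, (inner ℂ x (A y) : ℂ) =
      (inner ℂ (x + y) (A (x + y)) - inner ℂ (x - y) (A (x - y))
        - Complex.I * inner ℂ (x + Complex.I • y) (A (x + Complex.I • y))
        + Complex.I * inner ℂ (x - Complex.I • y) (A (x - Complex.I • y))) / 4 := fun A => by
    simp only [map_add, map_sub, map_smul, inner_add_left, inner_add_right, inner_sub_left,
      inner_sub_right, inner_smul_left, inner_smul_right, Complex.conj_I]
    linear_combination (1 / 2 : ℂ) * (inner ℂ x (A y) - inner ℂ y (A x)) * Complex.I_sq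
  have hs := J.hasSum_inner_effect_self hX hd
  rw [hpol, funext fun n => hpol (J.toFun (X n)).effect]
  exact ((((hs (x + y)).sub (hs (x - y))).sub ((hs (x + Complex.I • y)).mul_left Complex.I)).add
    ((hs (x - Complex.I • y)).mul_left Complex.I)).div_const 4

/-- The observable `X ↦ (J X)*(I)` associated with an instrument `J`. -/
noncomputable def Instrument.toObservable (J : Instrument Ω H) : Observable Ω H where
  toFun X := (J.toFun X).effect
  isEffect X _ := (J.toFun X).isEffect_effect
  sigma_additive _ hX hd x y := J.hasSum_inner_effect hX hd x y
  univ_eq_one := (J.toFun Set.univ).effect_eq_one J.normalized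

theorem Instrument.effect_mem_range_toObservable (J : Instrument Ω H) {Φ : Operation H}
    (h : Φ ∈ J.range) : Φ.effect ∈ J.toObservable.range := by
  obtain ⟨X, hX, rfl⟩ := h
  exact ⟨X, hX, rfl⟩

end Instrument

end

end Quantum

theorem proposition5 {H : Type u} [NormedAddCommGroup H] [InnerProductSpace ℂ H]
    [CompleteSpace H] [TopologicalSpace.SeparableSpace H] (Φ Ψ : Quantum.Operation H)
    (h : Quantum.Operation.Coexistent.{u, v} Φ Ψ) :
    Quantum.EffectCoexistent.{u, v} Φ.effect Ψ.effect := by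
  obtain ⟨Ω, mΩ, J, hΦ, hΨ⟩ := h
  exact ⟨Ω, mΩ, J.toObservable, J.effect_mem_range_toObservable hΦ,
    J.effect_mem_range_toObservable hΨ⟩
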